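/- Let $\chi_{4,5}$ be the Dirichlet character modulo $5$ with $\langle\chi_{4,5}(n)\rangle_{n=0}^{4}=\langle 0,1,-i,i,-1\rangle$, let $q\in\mathbb{C}$ with $|q|<1$, and write $(a;q)_\infty=\prod_{k\ge 0}(1-aq^k)$. Inner sums run over positive divisors. Then the following series converge and $$\sum_{n=0}^\infty\Bigl(\sum_{d\mid 5n+4}\chi_{4,5}(d)\Bigr)q^n=\frac{-i\,(q;q)_\infty(q^5;q^5)_\infty}{(q^2;q^5)_\infty^3(q^3;q^5)_\infty^3},\qquad \sum_{n=0}^\infty\Bigl(\sum_{d\mid 5n+3}\chi_{4,5}(d)\Bigr)q^n=\frac{(1+i)(q^5;q^5)_\infty^2}{(q^2;q^5)_\infty(q^3;q^5)_\infty},$$ $$\sum_{n=0}^\infty\Bigl(\sum_{d\mid 5n+2}\chi_{4,5}(d)\Bigr)q^n=\frac{(1-i)(q^5;q^5)_\infty^2}{(q;q^5)_\infty(q^4;q^5)_\infty},\qquad \sum_{n=0}^\infty\Bigl(\sum_{d\mid 5n+1}\chi_{4,5}(d)\Bigr)q^n=\frac{(q;q)_\infty(q^5;q^5)_\infty}{(q;q^5)_\infty^3(q^4;q^5)_\infty^3}.$$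 Moreover, let $q^{1/5}$ be any fifth root of $q$, with $q^{k/5}=(q^{1/5})^k$, and set $$A=q^{1/5}(q;q)_\infty^{-3/5}\sum_{n=-\infty}^{\infty}(-1)^nq^{(5n^2-3n)/2},\qquad B=(q;q)_\infty^{-3/5}\sum_{n=-\infty}^{\infty}(-1)^nq^{(5n^2-n)/2},$$ where $(q;q)_\infty^{-3/5}$ is the branch that is holomorphic in $|q|<1$ and equals $1$ at $q=0$. Then $$q^{4/5}\sum_{n=0}^\infty\Bigl(\sum_{d\mid 5n+4}\chi_{4,5}(d)\Bigr)q^n=-iA^4B,\qquad q^{3/5}\sum_{n=0}^\infty\Bigl(\sum_{d\mid 5n+3}\chi_{4,5}(d)\Bigr)q^n=(1+i)A^3B^2,$$ $$q^{2/5}\sum_{n=0}^\infty\Bigl(\sum_{d\mid 5n+2}\chi_{4,5}(d)\Bigr)q^n=(1-i)A^2B^3,\qquad q^{1/5}\sum_{n=0}^\infty\Bigl(\sum_{d\mid 5n+1}\chi_{4,5}(d)\Bigr)q^n=AB^4.$$ -/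

import Mathlib

/-- The infinite product `(a; q)_∞ = ∏_{k ≥ 0} (1 - a q^k)`. -/
noncomputable def qPoch (a q : ℂ) : ℂ := ∏' k : ℕ, (1 - a * q ^ k)

/-- For `|q| < 1` the product converges, so that `qPoch a q` is the limit of `(a; q)_n`. -/
theorem tendsto_qPoch (a q : ℂ) (hq : ‖q‖ < 1) :
    Filter.Tendsto (fun n : ℕ => ∏ k ∈ Finset.range n, (1 - a * q ^ k)) Filter.atTop
      (nhds (qPoch a q)) := by
  have hs : Summable fun k : ℕ => ‖-(a * q ^ k)‖ := by
    simpa [norm_neg, norm_mul, norm_pow] using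
      (summable_geometric_of_lt_one (norm_nonneg q) hq).mul_left ‖a‖
  have hm : Multipliable fun k : ℕ => 1 + -(a * q ^ k) := multipliable_one_add_of_summable hs
  simpa [qPoch, sub_eq_add_neg] using hm.hasProd.tendsto_prod_nat

/-- The power `(q; q)_∞ ^ s` for `|q| < 1`: the branch that is holomorphic in `q` on the unit disc
and equals `1` at `q = 0`, obtained by summing the principal logarithms of the factors
`1 - q ^ (n + 1)` (which have positive real part). -/
noncomputable def qqPow (q s : ℂ) : ℂ :=
  Complex.exp (s * ∑' n : ℕ, Complex.log (1 - q ^ (n + 1)))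

theorem qqPow_one (q : ℂ) (hq : ‖q‖ < 1) : qqPow q 1 = qPoch q q := by
  have hs : Summable fun n : ℕ => -(q ^ (n + 1)) := by
    have := ((summable_geometric_of_norm_lt_one hq).mul_left q).neg
    simpa [pow_succ'] using this
  have hl := Complex.summable_log_one_add_of_summable hs
  have h0 : ∀ n : ℕ, 1 + -(q ^ (n + 1)) ≠ 0 := by
    intro n h
    have h1 : q ^ (n + 1) = 1 := by linear_combination -h
    have h2 : ‖q‖ ^ (n + 1) = 1 := by rw [← norm_pow, h1, norm_one]
    exact absurd h2 (pow_lt_one₀ (norm_nonneg q) hq (Nat.succ_ne_zero n)).ne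
  have := Complex.cexp_tsum_eq_tprod h0 hl
  simpa [qqPow, qPoch, sub_eq_add_neg, pow_succ'] using this

/-- The bilateral theta series below converge for `|q| < 1`. -/
theorem summable_quintic_theta (q : ℂ) (hq : ‖q‖ < 1) (e : ℤ → ℤ) (he : ∀ n, |n| ≤ e n) :
    Summable fun n : ℤ => (-1 : ℂ) ^ n * q ^ e n := by
  have hg : Summable fun n : ℤ => ‖q‖ ^ n.natAbs := by
    apply Summable.of_nat_of_neg <;>
      simpa using summable_geometric_of_lt_one (norm_nonneg q) hq
  refine Summable.of_norm_bounded hg fun n => ?_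
  have h1 : e n = ((e n).toNat : ℤ) := by
    have := (abs_nonneg n).trans (he n)
    omega
  have h2 : n.natAbs ≤ (e n).toNat := by
    have h3 := he n
    rw [Int.abs_eq_natAbs] at h3
    omega
  rw [h1, zpow_natCast, norm_mul, norm_zpow, norm_neg, norm_one, one_zpow, one_mul, norm_pow]
  exact pow_le_pow_of_le_one (norm_nonneg q) hq.le h2

theorem abs_le_quintic_exponents (n : ℤ) :
    |n| ≤ (5 * n ^ 2 - 3 * n) / 2 ∧ |n| ≤ (5 * n ^ 2 - n) / 2 := by
  have h : |n| ≤ n ^ 2 := by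
    rw [← sq_abs]
    rcases (abs_nonneg n).eq_or_lt with h0 | h0
    · simp [← h0]
    · nlinarith
  have h3 := abs_le.mp h
  constructor <;> rw [Int.le_ediv_iff_mul_le (by norm_num)] <;>
    nlinarith [le_abs_self n, neg_abs_le n]

/-- The quintic theta function
`A(q) = q^{1/5} (q;q)_∞^{-3/5} ∑_{n ∈ ℤ} (-1)^n q^{(5n² - 3n)/2}`, written as a function of
a fifth root `t = q^{1/5}`, so that `q = t ^ 5`. -/
noncomputable def quinticA (t : ℂ) : ℂ :=
  t * qqPow (t ^ 5) (-3 / 5) *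
    ∑' n : ℤ, (-1 : ℂ) ^ n * (t ^ 5) ^ ((5 * n ^ 2 - 3 * n) / 2)

/-- The quintic theta function `B(q) = (q;q)_∞^{-3/5} ∑_{n ∈ ℤ} (-1)^n q^{(5n² - n)/2}`. -/
noncomputable def quinticB (q : ℂ) : ℂ :=
  qqPow q (-3 / 5) * ∑' n : ℤ, (-1 : ℂ) ^ n * q ^ ((5 * n ^ 2 - n) / 2)

/-- The Dirichlet character `χ_{4,5}` modulo `5` with values `0, 1, -i, i, -1` at
`0, 1, 2, 3, 4`. -/
noncomputable def chi45 : DirichletCharacter ℂ 5 where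
  toFun := ![0, 1, -Complex.I, Complex.I, -1]
  map_one' := rfl
  map_mul' := by
    intro a b
    change Fin 5 at a b
    fin_cases a <;> fin_cases b <;> simp [ZMod]
  map_nonunit' := by
    intro a ha
    have h : a = 0 := by
      by_contra h
      have : Fact (Nat.Prime 5) := ⟨by norm_num⟩
      exact ha (isUnit_iff_ne_zero.mpr h)
    subst h
    rfl

/-- The coefficient `∑_{d ∣ m} χ_{4,5}(d)`, the sum being over the positive divisors of `m`. -/
noncomputable def divisorSumChi45 (m : ℕ) : ℂ := ∑ d ∈ m.divisors, chi45 (d : ZMod 5)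

/-! Write a divisor `d` of `5n + r` together with its cofactor `e`. Since `r ≠ 0`, the residues of
`d` and `e` modulo 5 are nonzero and each determines the other, so the generating function is a
combination of four double series, one per residue pair `(a, b)`, each of the form `∑ x^j y^k
p^(jk)` with `p = q^5`, `x = q^b`, `y = q^a`. Because the character is odd, `(a, b)` and `(5 - a, 5
- b)` enter with opposite signs, which is exactly the difference that Kronecker's identity
(`kroneckerSeries_sub_eq`) evaluates as a quotient of theta functions.

Kronecker's identity comes from the bilateral series `F(x, y) = ∑ x^n / (1 - y p^n)`, which is
symmetric in `x, y`. Multiplying by `θ(x)` and comparing coefficients gives `F(x, y) θ(x) = C(y)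
θ(xy)`. Symmetry makes `C(y) θ(y)` independent of `y`, and letting the variable tend to 1 evaluates
it as `(p; p)_∞^3`.

For the second half, the triple product turns `A` and `B` into products over residue classes modulo
5. The monomials in `A`, `B` have total degree 5, so only the fifth power of `(q; q)_∞^(-3/5)`
occurs. -/

open Filter Topology Finset

/-! ### Jacobi's theta series: coefficients and convergence -/

/-- The coefficient `(-1) ^ n * p ^ (n (n - 1) / 2)` of Jacobi's theta series. -/
noncomputable def thetaCoeff (p : ℂ) (n : ℤ) : ℂ := (-1) ^ n * p ^ (n * (n - 1) / 2)

/-- Jacobi's theta series `∑_{n ∈ ℤ} (-1)^n p^{n(n-1)/2} x^n`. -/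
noncomputable def thetaSeries (p x : ℂ) : ℂ := ∑' n : ℤ, thetaCoeff p n * x ^ n

theorem thetaCoeff_succ {p : ℂ} (hp : p ≠ 0) (n : ℤ) :
    thetaCoeff p (n + 1) = -(p ^ n * thetaCoeff p n) := by
  have h : (n + 1) * (n + 1 - 1) / 2 = n * (n - 1) / 2 + n := by
    rw [← Int.add_mul_ediv_right _ _ (by norm_num)]
    congr 1
    ring
  rw [thetaCoeff, thetaCoeff, h, zpow_add₀ hp, zpow_add_one₀ (by norm_num)]
  ring

theorem thetaCoeff_one_sub (p : ℂ) (n : ℤ) : thetaCoeff p (1 - n) = -thetaCoeff p n := by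
  have h : (1 - n) * (1 - n - 1) = n * (n - 1) := by ring
  rw [thetaCoeff, thetaCoeff, h, zpow_sub₀ (by norm_num)]
  rcases Int.even_or_odd n with hn | hn <;> simp [hn.neg_one_zpow]

theorem thetaCoeff_ne_zero {p : ℂ} (hp : p ≠ 0) (n : ℤ) : thetaCoeff p n ≠ 0 :=
  mul_ne_zero (zpow_ne_zero _ (by norm_num)) (zpow_ne_zero _ hp)

theorem summable_norm_thetaCoeff_nat {p : ℂ} (hp : p ≠ 0) (hp1 : ‖p‖ < 1) {x : ℂ} (hx : x ≠ 0) :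
    Summable fun n : ℕ => ‖thetaCoeff p n * x ^ (n : ℤ)‖ := by
  refine summable_of_ratio_test_tendsto_lt_one (l := 0) zero_lt_one
    (Eventually.of_forall fun n => norm_ne_zero_iff.mpr
      (mul_ne_zero (thetaCoeff_ne_zero hp _) (zpow_ne_zero _ hx))) ?_
  have h := ((tendsto_pow_atTop_nhds_zero_of_lt_one (norm_nonneg p) hp1).mul_const ‖x‖)
  rw [zero_mul] at h
  refine h.congr fun n => ?_
  have h1 : thetaCoeff p (n + 1 : ℕ) * x ^ ((n + 1 : ℕ) : ℤ) =
      -(p ^ n * x) * (thetaCoeff p n * x ^ (n : ℤ)) := by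
    push_cast
    rw [thetaCoeff_succ hp, zpow_add_one₀ hx, zpow_natCast p]
    ring
  rw [norm_norm, norm_norm, ← norm_div, ← norm_pow, ← norm_mul, h1,
    mul_div_cancel_right₀ _ (mul_ne_zero (thetaCoeff_ne_zero hp _) (zpow_ne_zero _ hx)), norm_neg]

theorem summable_norm_thetaCoeff {p : ℂ} (hp : p ≠ 0) (hp1 : ‖p‖ < 1) {x : ℂ} (hx : x ≠ 0) :
    Summable fun n : ℤ => ‖thetaCoeff p n * x ^ n‖ := by
  refine Summable.of_nat_of_neg_add_one (summable_norm_thetaCoeff_nat hp hp1 hx) ?_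
  have h := ((summable_norm_thetaCoeff_nat hp hp1 (inv_ne_zero hx)).comp_injective
    (add_left_injective 2)).mul_left ‖x‖
  refine h.congr fun n => ?_
  have h3 : -((n : ℤ) + 1) = 1 - ((n + 2 : ℕ) : ℤ) := by push_cast; ring
  rw [h3, thetaCoeff_one_sub, Function.comp_apply, ← norm_mul, zpow_sub₀ hx, neg_mul, norm_neg]
  congr 1
  rw [inv_zpow]
  simp
  ring

theorem summable_thetaCoeff {p : ℂ} (hp : p ≠ 0) (hp1 : ‖p‖ < 1) {x : ℂ} (hx : x ≠ 0) :
    Summable fun n : ℤ => thetaCoeff p n * x ^ n :=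
  (summable_norm_thetaCoeff hp hp1 hx).of_norm

/-- The shift `n ↦ n + 1` turns the series into minus the sum of the coefficients, and the
reflection `n ↦ 1 - n` shows that this sum is its own negative. This zero removes the unwanted term
in `thetaFraction_succ`. -/
theorem thetaSeries_self {p : ℂ} (hp : p ≠ 0) : thetaSeries p p = 0 := by
  have h1 : thetaSeries p p = -∑' n : ℤ, thetaCoeff p n := by
    rw [← (Equiv.addRight (1 : ℤ)).tsum_eq, ← tsum_neg]
    refine tsum_congr fun n => ?_
    rw [Equiv.coe_addRight, thetaCoeff_succ hp]
    ring
  have h2 : ∑' n : ℤ, thetaCoeff p n = -∑' n : ℤ, thetaCoeff p n := by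
    conv_lhs => rw [← (Equiv.subLeft (1 : ℤ)).tsum_eq]
    rw [← tsum_neg]
    exact tsum_congr fun n => thetaCoeff_one_sub p n
  rw [h1]
  linear_combination (-1 / 2 : ℂ) * h2

/-! ### The triple product as a limit of its finite form -/

/-- `1 / (p; p)_k`, extended by zero to negative `k`. -/
noncomputable def invPoch (p : ℂ) (k : ℤ) : ℂ :=
  if k < 0 then 0 else (∏ i ∈ range k.toNat, (1 - p * p ^ i))⁻¹

theorem one_sub_mul_pow_ne_zero {a p : ℂ} (ha : ‖a‖ < 1) (hp1 : ‖p‖ < 1) (n : ℕ) :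
    1 - a * p ^ n ≠ 0 := by
  intro h
  have h1 : ‖a * p ^ n‖ = 1 := by rw [← sub_eq_zero.mp h, norm_one]
  rw [norm_mul, norm_pow] at h1
  nlinarith [pow_le_one₀ (norm_nonneg p) hp1.le (n := n), norm_nonneg a,
    pow_nonneg (norm_nonneg p) n]

theorem qPoch_ne_zero {a p : ℂ} (ha : ‖a‖ < 1) (hp1 : ‖p‖ < 1) : qPoch a p ≠ 0 := by
  have hs : Summable fun k : ℕ => ‖-(a * p ^ k)‖ := by
    simpa [norm_neg, norm_mul, norm_pow] using
      (summable_geometric_of_lt_one (norm_nonneg p) hp1).mul_left ‖a‖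
  have := tprod_one_add_ne_zero_of_summable (f := fun k : ℕ => -(a * p ^ k))
    (fun n => by simpa [sub_eq_add_neg] using one_sub_mul_pow_ne_zero ha hp1 n) hs
  simpa [qPoch, sub_eq_add_neg] using this

/-- The extension by zero makes the recurrence hold for every integer: at `k = 0` the factor `1 -
p^0` vanishes, matching the value 0 at `-1`. -/
theorem invPoch_mul_one_sub {p : ℂ} (hp1 : ‖p‖ < 1) (k : ℤ) :
    invPoch p k * (1 - p ^ k) = invPoch p (k - 1) := by
  rcases lt_trichotomy k 0 with hk | rfl | hk
  · simp [invPoch, hk, show k < 1 by omega]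
  · simp [invPoch]
  · obtain ⟨n, rfl⟩ : ∃ n : ℕ, k = n + 1 := ⟨(k - 1).toNat, by omega⟩
    have h := one_sub_mul_pow_ne_zero hp1 hp1 n
    rw [invPoch, invPoch, if_neg (by omega), if_neg (by omega), add_sub_cancel_right,
      show ((n : ℤ) + 1).toNat = n + 1 by omega, Int.toNat_natCast, prod_range_succ, mul_inv,
      show p ^ ((n : ℤ) + 1) = p * p ^ n by rw [← pow_succ']; exact_mod_cast zpow_natCast p (n + 1),
      mul_assoc, inv_mul_cancel₀ h, mul_one]

theorem tendsto_invPoch {p : ℂ} (hp1 : ‖p‖ < 1) :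
    Tendsto (fun n : ℕ => invPoch p n) atTop (𝓝 (qPoch p p)⁻¹) := by
  refine ((tendsto_qPoch p p hp1).inv₀ (qPoch_ne_zero hp1 hp1)).congr fun n => ?_
  simp [invPoch]

theorem exists_norm_invPoch_le {p : ℂ} (hp1 : ‖p‖ < 1) : ∃ C, 0 ≤ C ∧ ∀ k, ‖invPoch p k‖ ≤ C := by
  obtain ⟨C, hC⟩ := (tendsto_invPoch hp1).norm.bddAbove_range
  have h0 : ∀ n : ℕ, ‖invPoch p n‖ ≤ C := fun n => hC ⟨n, rfl⟩
  have hC0 : 0 ≤ C := (norm_nonneg _).trans (h0 0)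
  refine ⟨C, hC0, fun k => ?_⟩
  by_cases hk : k < 0
  · simpa [invPoch, hk] using hC0
  · obtain ⟨n, rfl⟩ := Int.eq_ofNat_of_zero_le (not_lt.mp hk)
    exact h0 n

/-- The finite form of Jacobi's triple product identity. -/
theorem hasSum_finite_triple_product {p x : ℂ} (hp : p ≠ 0) (hp1 : ‖p‖ < 1) (hx : x ≠ 0) (N : ℕ) :
    HasSum (fun j : ℤ => thetaCoeff p j * x ^ j *
        ((∏ i ∈ range (2 * N), (1 - p * p ^ i)) * invPoch p (N + j) * invPoch p (N - j)))
      ((∏ i ∈ range N, (1 - x * p ^ i)) * ∏ i ∈ range N, (1 - p / x * p ^ i)) := by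
  induction N with
  | zero =>
    convert hasSum_single (f := fun j : ℤ => thetaCoeff p j * x ^ j *
        ((∏ i ∈ range (2 * 0), (1 - p * p ^ i)) * invPoch p ((0 : ℕ) + j) *
          invPoch p ((0 : ℕ) - j))) 0 ?_ using 1
    · simp [thetaCoeff, invPoch]
    · intro j hj
      rcases lt_or_gt_of_ne hj with h | h <;> simp [invPoch, h]
  | succ N ih =>
    -- The new factor `(1 - x p^N)(1 - p^(N+1)/x)` expands to `1 + p^(2N+1) - p^N x - p^(N+1)/x`.
    -- Shifting the index by one absorbs the extra power of `x` in the last two terms.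
    have h1 := ih.mul_left (1 + p ^ (2 * N + 1))
    have h2 := (((Equiv.subRight (1 : ℤ)).hasSum_iff).mpr ih).mul_left (p ^ N * x)
    have h3 := (((Equiv.addRight (1 : ℤ)).hasSum_iff).mpr ih).mul_left (p ^ (N + 1) / x)
    have hval : (∏ i ∈ range (N + 1), (1 - x * p ^ i)) * ∏ i ∈ range (N + 1), (1 - p / x * p ^ i) =
        (1 + p ^ (2 * N + 1)) * ((∏ i ∈ range N, (1 - x * p ^ i)) *
          ∏ i ∈ range N, (1 - p / x * p ^ i)) -
        p ^ N * x * ((∏ i ∈ range N, (1 - x * p ^ i)) * ∏ i ∈ range N, (1 - p / x * p ^ i)) -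
        p ^ (N + 1) / x * ((∏ i ∈ range N, (1 - x * p ^ i)) *
          ∏ i ∈ range N, (1 - p / x * p ^ i)) := by
      rw [prod_range_succ, prod_range_succ]
      field_simp
      ring
    rw [hval]
    refine (congrArg (HasSum · _) (funext fun j => ?_)).mpr ((h1.sub h2).sub h3)
    have hs := zpow_ne_zero j hp
    have e1 : invPoch p (N + j) =
        invPoch p (((N + 1 : ℕ) : ℤ) + j) * (1 - p * p ^ N * p ^ j) := by
      rw [show (N : ℤ) + j = ((N + 1 : ℕ) : ℤ) + j - 1 by push_cast; ring,
        ← invPoch_mul_one_sub hp1, zpow_add₀ hp, zpow_natCast, pow_succ']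
    have e2 : invPoch p (N - j) =
        invPoch p (((N + 1 : ℕ) : ℤ) - j) * (1 - p * p ^ N / p ^ j) := by
      rw [show (N : ℤ) - j = ((N + 1 : ℕ) : ℤ) - j - 1 by push_cast; ring,
        ← invPoch_mul_one_sub hp1, zpow_sub₀ hp, zpow_natCast, pow_succ']
    have e3 : invPoch p (N + (j - 1)) = invPoch p (N + j) * (1 - p ^ N * p ^ j) := by
      rw [show (N : ℤ) + (j - 1) = N + j - 1 by ring,
        ← invPoch_mul_one_sub hp1, zpow_add₀ hp, zpow_natCast]
    have e4 : invPoch p (N - (j + 1)) = invPoch p (N - j) * (1 - p ^ N / p ^ j) := by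
      rw [show (N : ℤ) - (j + 1) = N - j - 1 by ring,
        ← invPoch_mul_one_sub hp1, zpow_sub₀ hp, zpow_natCast]
    have e5 : thetaCoeff p (j - 1) = -(p / p ^ j * thetaCoeff p j) := by
      have := thetaCoeff_succ hp (j - 1)
      rw [sub_add_cancel, zpow_sub_one₀ hp] at this
      rw [this]
      field_simp
    have e6 : (N : ℤ) - (j - 1) = ((N + 1 : ℕ) : ℤ) - j := by push_cast; ring
    have e7 : (N : ℤ) + (j + 1) = ((N + 1 : ℕ) : ℤ) + j := by push_cast; ring
    simp only [Function.comp_apply, Equiv.subRight_apply, Equiv.coe_addRight]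
    rw [e3, e4, e5, e6, e7, e1, e2, thetaCoeff_succ hp, zpow_sub_one₀ hx, zpow_add_one₀ hx,
      show 2 * (N + 1) = 2 * N + 1 + 1 by ring, prod_range_succ, prod_range_succ]
    generalize invPoch p (((N + 1 : ℕ) : ℤ) + j) = u
    generalize invPoch p (((N + 1 : ℕ) : ℤ) - j) = v
    generalize ∏ i ∈ range (2 * N), (1 - p * p ^ i) = R
    generalize thetaCoeff p j = W
    generalize x ^ j = X
    generalize p ^ j = s at *
    simp only [pow_succ, pow_mul', pow_zero, one_mul]
    generalize p ^ N = n
    field_simp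
    ring

/-- **Jacobi's triple product identity**. -/
theorem thetaSeries_eq {p x : ℂ} (hp : p ≠ 0) (hp1 : ‖p‖ < 1) (hx : x ≠ 0) :
    thetaSeries p x = qPoch x p * qPoch (p / x) p * qPoch p p := by
  obtain ⟨C, hC0, hC⟩ := exists_norm_invPoch_le hp1
  obtain ⟨M, hM⟩ := (tendsto_qPoch p p hp1).norm.bddAbove_range
  have hM' : ∀ n : ℕ, ‖∏ k ∈ range n, (1 - p * p ^ k)‖ ≤ M := fun n => hM ⟨n, rfl⟩
  have hM0 : 0 ≤ M := (norm_nonneg _).trans (hM' 0)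
  have hP := qPoch_ne_zero hp1 hp1
  have key := tendsto_tsum_of_dominated_convergence (𝓕 := atTop)
    (f := fun (N : ℕ) (j : ℤ) => thetaCoeff p j * x ^ j *
        ((∏ i ∈ range (2 * N), (1 - p * p ^ i)) * invPoch p (N + j) * invPoch p (N - j)))
    (g := fun j : ℤ => thetaCoeff p j * x ^ j *
      (qPoch p p * (qPoch p p)⁻¹ * (qPoch p p)⁻¹))
    (bound := fun j => ‖thetaCoeff p j * x ^ j‖ * (M * C * C))
    ((summable_norm_thetaCoeff hp hp1 hx).mul_right _) ?_ ?_
  · have h2 := (tendsto_qPoch x p hp1).mul (tendsto_qPoch (p / x) p hp1)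
    have h3 := tendsto_nhds_unique key
      (h2.congr fun N => (hasSum_finite_triple_product hp hp1 hx N).tsum_eq.symm)
    rw [tsum_mul_right, mul_inv_cancel₀ hP, one_mul] at h3
    rw [← h3, thetaSeries, inv_mul_cancel_right₀ hP]
  · intro j
    refine Tendsto.const_mul _ (Tendsto.mul (Tendsto.mul ?_ ?_) ?_)
    · exact (tendsto_qPoch p p hp1).comp (tendsto_id.const_mul_atTop' (by norm_num))
    · have h : Tendsto (fun N : ℕ => ((N : ℤ) + j).toNat) atTop atTop :=
        tendsto_atTop_atTop.mpr fun b => ⟨b + j.natAbs, fun a ha => by omega⟩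
      refine ((tendsto_invPoch hp1).comp h).congr' ?_
      filter_upwards [eventually_ge_atTop j.natAbs] with N hN
      rw [Function.comp_apply, Int.toNat_of_nonneg (by omega)]
    · have h : Tendsto (fun N : ℕ => ((N : ℤ) - j).toNat) atTop atTop :=
        tendsto_atTop_atTop.mpr fun b => ⟨b + j.natAbs, fun a ha => by omega⟩
      refine ((tendsto_invPoch hp1).comp h).congr' ?_
      filter_upwards [eventually_ge_atTop j.natAbs] with N hN
      rw [Function.comp_apply, Int.toNat_of_nonneg (by omega)]
  · refine Eventually.of_forall fun N j => ?_
    rw [norm_mul, norm_mul _ (invPoch p (N - j)), norm_mul _ (invPoch p (N + j))]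
    gcongr
    exacts [hM' _, hC _, hC _]

theorem continuous_qPoch_left {p : ℂ} (hp1 : ‖p‖ < 1) : Continuous fun a => qPoch a p := by
  rw [continuous_iff_continuousAt]
  intro a
  have h := Summable.hasProdLocallyUniformlyOn_nat_one_add (K := Metric.ball (0 : ℂ) (‖a‖ + 1))
    (f := fun (n : ℕ) (b : ℂ) => -(b * p ^ n)) (u := fun n => (‖a‖ + 1) * ‖p‖ ^ n)
    Metric.isOpen_ball ((summable_geometric_of_lt_one (norm_nonneg p) hp1).mul_left _)
    (Eventually.of_forall fun n b hb => by
      rw [norm_neg, norm_mul, norm_pow]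
      gcongr
      exact (mem_ball_zero_iff.mp hb).le)
    (fun n => by fun_prop)
  rw [hasProdLocallyUniformlyOn_iff_tendstoLocallyUniformlyOn] at h
  have hc := h.continuousOn (Frequently.of_forall fun s => by fun_prop)
  refine (hc.continuousAt (Metric.isOpen_ball.mem_nhds (by simp))).congr
    (Eventually.of_forall fun b => ?_)
  simp [qPoch, sub_eq_add_neg]

theorem qPoch_eq_one_sub_mul {p : ℂ} (hp1 : ‖p‖ < 1) (a : ℂ) :
    qPoch a p = (1 - a) * qPoch (a * p) p := by
  refine tendsto_nhds_unique ((tendsto_qPoch a p hp1).comp (tendsto_add_atTop_nat 1))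
    (((tendsto_qPoch (a * p) p hp1).const_mul (1 - a)).congr fun n => ?_)
  rw [Function.comp_apply, prod_range_succ', pow_zero, mul_one, mul_comm]
  congr 1
  exact prod_congr rfl fun k _ => by ring

/-! ### Kronecker's series and its symmetry -/

/-- The double series `∑_{j, k ≥ 0} x^j y^k p^{jk}`. -/
noncomputable def kroneckerSeries (p x y : ℂ) : ℂ :=
  ∑' i : ℕ × ℕ, x ^ i.1 * y ^ i.2 * p ^ (i.1 * i.2)

theorem summable_kroneckerSeries {p x y : ℂ} (hp1 : ‖p‖ < 1) (hx1 : ‖x‖ < 1) (hy1 : ‖y‖ < 1) :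
    Summable fun i : ℕ × ℕ => x ^ i.1 * y ^ i.2 * p ^ (i.1 * i.2) := by
  have h := (summable_geometric_of_lt_one (norm_nonneg x) hx1).mul_of_nonneg
    (summable_geometric_of_lt_one (norm_nonneg y) hy1) (fun n => by positivity)
    (fun n => by positivity)
  refine Summable.of_norm_bounded h fun i => ?_
  rw [norm_mul, norm_mul, norm_pow, norm_pow, norm_pow]
  exact mul_le_of_le_one_right (by positivity) (pow_le_one₀ (norm_nonneg p) hp1.le)

theorem kroneckerSeries_comm (p x y : ℂ) : kroneckerSeries p x y = kroneckerSeries p y x := by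
  rw [kroneckerSeries, ← (Equiv.prodComm ℕ ℕ).tsum_eq]
  exact tsum_congr fun i => by
    simp only [Equiv.prodComm_apply, Prod.fst_swap, Prod.snd_swap, mul_comm i.2 i.1]
    ring

theorem hasSum_kroneckerSeries {p x y : ℂ} (hp1 : ‖p‖ < 1) (hx1 : ‖x‖ < 1) (hy1 : ‖y‖ < 1) :
    HasSum (fun j : ℕ => x ^ j / (1 - y * p ^ j)) (kroneckerSeries p x y) := by
  refine (summable_kroneckerSeries hp1 hx1 hy1).hasSum.prod_fiberwise fun j => ?_
  have h : ‖y * p ^ j‖ < 1 := by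
    rw [norm_mul, norm_pow]
    exact mul_lt_one_of_nonneg_of_lt_one_left (norm_nonneg y) hy1
      (pow_le_one₀ (norm_nonneg p) hp1.le)
  rw [div_eq_mul_inv]
  refine (congrArg (HasSum · _) (funext fun k => ?_)).mpr
    ((hasSum_geometric_of_norm_lt_one h).mul_left (x ^ j))
  rw [mul_pow, ← pow_mul]
  ring

/-- The bilateral series `∑_{n ∈ ℤ} x^n / (1 - y p^n)`. -/
noncomputable def bilateralKronecker (p x y : ℂ) : ℂ := ∑' n : ℤ, x ^ n / (1 - y * p ^ n)

/-- The terms with `n ≥ 0` expand geometrically in `y p^n`. For `n = -m < 0` one rewrites `1 / (1 -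
y p^(-m))` as `-(p^m / y) / (1 - p^m / y)`, which is the same kind of series in `p/x`, `p/y`. -/
theorem hasSum_bilateralKronecker {p x y : ℂ} (hp : p ≠ 0) (hp1 : ‖p‖ < 1)
    (hx : ‖p‖ < ‖x‖) (hx1 : ‖x‖ < 1) (hy : ‖p‖ < ‖y‖) (hy1 : ‖y‖ < 1) :
    HasSum (fun n : ℤ => x ^ n / (1 - y * p ^ n))
      (kroneckerSeries p x y - p / (x * y) * kroneckerSeries p (p / x) (p / y)) := by
  have hx0 : x ≠ 0 := norm_pos_iff.mp ((norm_nonneg p).trans_lt hx)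
  have hy0 : y ≠ 0 := norm_pos_iff.mp ((norm_nonneg p).trans_lt hy)
  have hx' : ‖p / x‖ < 1 := by rwa [norm_div, div_lt_one ((norm_nonneg p).trans_lt hx)]
  have hy' : ‖p / y‖ < 1 := by rwa [norm_div, div_lt_one ((norm_nonneg p).trans_lt hy)]
  rw [sub_eq_add_neg, ← neg_mul]
  refine HasSum.of_nat_of_neg_add_one ?_ ?_
  · simpa only [zpow_natCast] using hasSum_kroneckerSeries hp1 hx1 hy1
  · refine (congrArg (HasSum · _) (funext fun n => ?_)).mpr
      ((hasSum_kroneckerSeries hp1 hx' hy').mul_left (-(p / (x * y))))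
    have h1 := one_sub_mul_pow_ne_zero hy' hp1 n
    have h2 : 1 - y * p ^ (-((n : ℤ) + 1)) = -(y / p ^ (n + 1)) * (1 - p / y * p ^ n) := by
      rw [zpow_neg, show p ^ ((n : ℤ) + 1) = p ^ (n + 1) by exact_mod_cast zpow_natCast p (n + 1)]
      field_simp
      ring
    rw [h2, zpow_neg, show x ^ ((n : ℤ) + 1) = x ^ (n + 1) by
      exact_mod_cast zpow_natCast x (n + 1), div_pow]
    generalize 1 - p / y * p ^ n = s at *
    field_simp
    ring

theorem bilateralKronecker_comm {p x y : ℂ} (hp : p ≠ 0) (hp1 : ‖p‖ < 1)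
    (hx : ‖p‖ < ‖x‖) (hx1 : ‖x‖ < 1) (hy : ‖p‖ < ‖y‖) (hy1 : ‖y‖ < 1) :
    bilateralKronecker p x y = bilateralKronecker p y x := by
  rw [bilateralKronecker, bilateralKronecker,
    (hasSum_bilateralKronecker hp hp1 hx hx1 hy hy1).tsum_eq,
    (hasSum_bilateralKronecker hp hp1 hy hy1 hx hx1).tsum_eq,
    kroneckerSeries_comm p x, kroneckerSeries_comm p (p / x), mul_comm x]

/-! ### Partial fractions and the constant in Kronecker's identity -/

/-- For `m ≠ 0`, `‖y p^m‖` is at most `‖y‖ ‖p‖` or at least `‖y‖ / ‖p‖`. Leaving out `m = 0` keeps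
the bound positive as `y → 1`. -/
theorem le_norm_one_sub_mul_zpow {p y : ℂ} (hp : p ≠ 0) (hp1 : ‖p‖ < 1) {m : ℤ} (hm : m ≠ 0) :
    min (1 - ‖y‖ * ‖p‖) (‖y‖ / ‖p‖ - 1) ≤ ‖1 - y * p ^ m‖ := by
  have hp0 := norm_pos_iff.mpr hp
  rcases lt_or_gt_of_ne hm with h | h
  · have h1 : ‖y‖ / ‖p‖ ≤ ‖y * p ^ m‖ := by
      rw [norm_mul, norm_zpow, div_eq_mul_inv, ← zpow_neg_one]
      exact mul_le_mul_of_nonneg_left (zpow_le_zpow_right_of_le_one₀ hp0 hp1.le (by omega))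
        (norm_nonneg y)
    have h2 := norm_sub_norm_le (y * p ^ m) 1
    rw [norm_one, norm_sub_rev] at h2
    exact (min_le_right _ _).trans (by linarith)
  · have h1 : ‖y * p ^ m‖ ≤ ‖y‖ * ‖p‖ := by
      rw [norm_mul, norm_zpow]
      refine mul_le_mul_of_nonneg_left ?_ (norm_nonneg y)
      simpa using zpow_le_zpow_right_of_le_one₀ hp0 hp1.le (show 1 ≤ m by omega)
    have h2 := norm_sub_norm_le 1 (y * p ^ m)
    rw [norm_one] at h2
    exact (min_le_left _ _).trans (by linarith)

theorem exists_pos_le_norm_one_sub_mul_zpow {p y : ℂ} (hp : p ≠ 0) (hp1 : ‖p‖ < 1)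
    (hy : ‖p‖ < ‖y‖) (hy1 : ‖y‖ < 1) : ∃ δ > 0, ∀ m : ℤ, δ ≤ ‖1 - y * p ^ m‖ := by
  have hp0 := norm_pos_iff.mpr hp
  refine ⟨min (1 - ‖y‖) (‖y‖ / ‖p‖ - 1), lt_min (by linarith)
    (by rw [sub_pos, one_lt_div hp0]; exact hy), fun m => ?_⟩
  by_cases hm : m = 0
  · have h2 := norm_sub_norm_le 1 y
    rw [norm_one] at h2
    simpa [hm] using Or.inl h2
  · refine le_trans (min_le_min_right _ ?_) (le_norm_one_sub_mul_zpow hp hp1 hm)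
    nlinarith [norm_nonneg y]

theorem thetaCoeff_zero (p : ℂ) : thetaCoeff p 0 = 1 := by simp [thetaCoeff]

theorem summable_norm_thetaCoeff_sub {p : ℂ} (hp : p ≠ 0) (hp1 : ‖p‖ < 1) (N : ℤ) :
    Summable fun m : ℤ => ‖thetaCoeff p (N - m)‖ := by
  have h := (Equiv.subLeft N).summable_iff.mpr (summable_norm_thetaCoeff hp hp1 one_ne_zero)
  simpa [Function.comp_def] using h

/-- The partial fraction series `∑_m (-1)^(N-m) p^{(N-m)(N-m-1)/2} / (1 - y p^m)`. -/
noncomputable def thetaFraction (p y : ℂ) (N : ℤ) : ℂ :=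
  ∑' m : ℤ, thetaCoeff p (N - m) / (1 - y * p ^ m)

theorem summable_thetaFraction {p y : ℂ} (hp : p ≠ 0) (hp1 : ‖p‖ < 1)
    (hy : ‖p‖ < ‖y‖) (hy1 : ‖y‖ < 1) (N : ℤ) :
    Summable fun m : ℤ => thetaCoeff p (N - m) / (1 - y * p ^ m) := by
  obtain ⟨δ, hδ, h⟩ := exists_pos_le_norm_one_sub_mul_zpow hp hp1 hy hy1
  refine Summable.of_norm_bounded ((summable_norm_thetaCoeff_sub hp hp1 N).div_const δ)
    fun m => ?_
  rw [norm_div]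
  gcongr
  exact h m

/-- Split `p^(N-m) = p^(N-m) (1 - y p^m) + p^N y`: the first part cancels the denominator and sums
to `θ(p) = 0`. -/
theorem thetaFraction_succ {p y : ℂ} (hp : p ≠ 0) (hp1 : ‖p‖ < 1)
    (hy : ‖p‖ < ‖y‖) (hy1 : ‖y‖ < 1) (N : ℤ) :
    thetaFraction p y (N + 1) = -(p ^ N * y) * thetaFraction p y N := by
  obtain ⟨δ, hδ, hδ'⟩ := exists_pos_le_norm_one_sub_mul_zpow hp hp1 hy hy1
  have h0 : HasSum (fun m : ℤ => thetaCoeff p (N - m) * p ^ (N - m)) 0 := by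
    have h := (Equiv.subLeft N).hasSum_iff.mpr (summable_thetaCoeff hp hp1 hp).hasSum
    rw [← thetaSeries, thetaSeries_self hp] at h
    simpa only [Function.comp_def, Equiv.subLeft_apply] using h
  have h1 := h0.neg.add
    ((summable_thetaFraction hp hp1 hy hy1 N).hasSum.mul_left (-(p ^ N * y)))
  rw [neg_zero, zero_add] at h1
  rw [thetaFraction, thetaFraction, ← h1.tsum_eq]
  refine tsum_congr fun m => ?_
  have h2 : 1 - y * p ^ m ≠ 0 := norm_pos_iff.mp (hδ.trans_le (hδ' m))
  have h3 := zpow_ne_zero m hp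
  rw [show N + 1 - m = N - m + 1 by ring, thetaCoeff_succ hp, zpow_sub₀ hp]
  have h4 := div_mul_cancel₀ (thetaCoeff p (N - m)) h2
  rw [neg_div, mul_div_assoc]
  generalize thetaCoeff p (N - m) / (1 - y * p ^ m) = u at *
  rw [← h4]
  generalize p ^ m = s at *
  field_simp
  ring

/-- Both `thetaFraction p y N` and `thetaCoeff p N * y ^ N` satisfy the same first-order recurrence,
so their ratio does not depend on `N`. -/
theorem thetaFraction_eq {p y : ℂ} (hp : p ≠ 0) (hp1 : ‖p‖ < 1)
    (hy : ‖p‖ < ‖y‖) (hy1 : ‖y‖ < 1) (N : ℤ) :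
    thetaFraction p y N = thetaCoeff p N * y ^ N * thetaFraction p y 0 := by
  have hy0 : y ≠ 0 := norm_pos_iff.mp ((norm_nonneg p).trans_lt hy)
  have hstep : ∀ n : ℤ, thetaFraction p y (n + 1) / (thetaCoeff p (n + 1) * y ^ (n + 1)) =
      thetaFraction p y n / (thetaCoeff p n * y ^ n) := fun n => by
    have h1 := thetaCoeff_ne_zero hp n
    have h2 := zpow_ne_zero n hy0
    have h3 := zpow_ne_zero n hp
    rw [thetaFraction_succ hp hp1 hy hy1, thetaCoeff_succ hp, zpow_add_one₀ hy0]
    field_simp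
  have h : thetaFraction p y N / (thetaCoeff p N * y ^ N) = thetaFraction p y 0 := by
    induction N using Int.induction_on with
    | zero => simp [thetaCoeff_zero]
    | succ n ih => rw [hstep, ih]
    | pred n ih => rw [← hstep, sub_add_cancel, ih]
  rw [div_eq_iff (mul_ne_zero (thetaCoeff_ne_zero hp N) (zpow_ne_zero N hy0))] at h
  rw [h, mul_comm]

/-- In the Cauchy product of the two bilateral series the coefficient of `x^N` is `thetaFraction p y
N`. -/
theorem bilateralKronecker_mul_thetaSeries {p x y : ℂ} (hp : p ≠ 0) (hp1 : ‖p‖ < 1)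
    (hx : ‖p‖ < ‖x‖) (hx1 : ‖x‖ < 1) (hy : ‖p‖ < ‖y‖) (hy1 : ‖y‖ < 1) :
    bilateralKronecker p x y * thetaSeries p x = thetaFraction p y 0 * thetaSeries p (x * y) := by
  have hx0 : x ≠ 0 := norm_pos_iff.mp ((norm_nonneg p).trans_lt hx)
  have hF := (hasSum_bilateralKronecker hp hp1 hx hx1 hy hy1).summable.norm
  have hT := summable_norm_thetaCoeff hp hp1 hx0
  let e : ℤ × ℤ ≃ ℤ × ℤ :=
    { toFun := fun i => (i.2, i.1 - i.2)
      invFun := fun i => (i.1 + i.2, i.1)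
      left_inv := fun i => by simp
      right_inv := fun i => by simp }
  have hs := e.summable_iff.mpr (summable_mul_of_summable_norm hF hT)
  rw [bilateralKronecker, thetaSeries, tsum_mul_tsum_of_summable_norm hF hT, ← e.tsum_eq]
  rw [Function.comp_def] at hs
  rw [hs.tsum_prod, thetaSeries, ← tsum_mul_left]
  refine tsum_congr fun N => ?_
  have h : ∀ m : ℤ, x ^ m / (1 - y * p ^ m) * (thetaCoeff p (N - m) * x ^ (N - m)) =
      x ^ N * (thetaCoeff p (N - m) / (1 - y * p ^ m)) := fun m => by
    have := zpow_ne_zero m hx0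
    rw [zpow_sub₀ hx0]
    field_simp
  simp only [e, Equiv.coe_fn_mk, h]
  rw [tsum_mul_left, ← thetaFraction, thetaFraction_eq hp hp1 hy hy1, mul_zpow]
  ring

theorem thetaSeries_ne_zero {p x : ℂ} (hp : p ≠ 0) (hp1 : ‖p‖ < 1)
    (hx : ‖p‖ < ‖x‖) (hx1 : ‖x‖ < 1) : thetaSeries p x ≠ 0 := by
  have hx0 : x ≠ 0 := norm_pos_iff.mp ((norm_nonneg p).trans_lt hx)
  have hx' : ‖p / x‖ < 1 := by rwa [norm_div, div_lt_one ((norm_nonneg p).trans_lt hx)]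
  rw [thetaSeries_eq hp hp1 hx0]
  exact mul_ne_zero (mul_ne_zero (qPoch_ne_zero hx1 hp1) (qPoch_ne_zero hx' hp1))
    (qPoch_ne_zero hp1 hp1)

theorem tendsto_one_sub_mul_thetaFraction {p : ℂ} (hp : p ≠ 0) (hp1 : ‖p‖ < 1) :
    Tendsto (fun y => (1 - y) * thetaFraction p y 0) (𝓝[Metric.ball 0 1] (1 : ℂ)) (𝓝 1) := by
  have hp0 := norm_pos_iff.mpr hp
  -- This lies strictly below both `1 - ‖p‖` and `1 / ‖p‖ - 1`, the limits of the two lower bounds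
  -- for the denominators with `m ≠ 0`.
  set δ := (1 - ‖p‖) / 2 with hδdef
  have hδ : 0 < δ := by rw [hδdef]; linarith
  have hc1 : Tendsto (fun y : ℂ => 1 - ‖y‖ * ‖p‖) (𝓝[Metric.ball 0 1] (1 : ℂ))
      (𝓝 (1 - ‖(1 : ℂ)‖ * ‖p‖)) := (Continuous.tendsto (by fun_prop) _).mono_left nhdsWithin_le_nhds
  have hc2 : Tendsto (fun y : ℂ => ‖y‖ / ‖p‖ - 1) (𝓝[Metric.ball 0 1] (1 : ℂ))
      (𝓝 (‖(1 : ℂ)‖ / ‖p‖ - 1)) := (Continuous.tendsto (by fun_prop) _).mono_left nhdsWithin_le_nhds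
  have h1 := hc1.eventually_const_lt (show δ < _ by rw [norm_one]; linarith)
  have h2 := hc2.eventually_const_lt (show δ < _ by
    rw [norm_one, lt_sub_iff_add_lt, lt_div_iff₀ hp0]
    nlinarith)
  have hball : ∀ᶠ y in 𝓝[Metric.ball 0 1] (1 : ℂ), ‖y‖ < 1 := by
    filter_upwards [self_mem_nhdsWithin] with y hy using mem_ball_zero_iff.mp hy
  have key := tendsto_tsum_of_dominated_convergence (𝓕 := 𝓝[Metric.ball 0 1] (1 : ℂ))
    (f := fun y m => (1 - y) * (thetaCoeff p (0 - m) / (1 - y * p ^ m)))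
    (g := fun m : ℤ => if m = 0 then 1 else 0)
    (bound := fun m => ‖thetaCoeff p (0 - m)‖ * (1 + 2 / δ))
    ((summable_norm_thetaCoeff_sub hp hp1 0).mul_right _) ?_ ?_
  · rw [tsum_ite_eq] at key
    exact key.congr fun y => by rw [tsum_mul_left, thetaFraction]
  · intro m
    split_ifs with hm
    -- Only `m = 0` has a pole at `y = 1`; inside the open ball its term times `1 - y` is exactly 1.
    · refine Tendsto.congr' ?_ tendsto_const_nhds
      filter_upwards [hball] with y hy
      have : 1 - y ≠ 0 := by simpa using one_sub_mul_pow_ne_zero hy hp1 0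
      simp [hm, thetaCoeff_zero, this]
    · have hne : 1 - 1 * p ^ m ≠ 0 := by
        refine norm_pos_iff.mp (lt_of_lt_of_le (lt_min ?_ ?_) (le_norm_one_sub_mul_zpow hp hp1 hm))
        · rw [norm_one]; linarith
        · rw [norm_one, sub_pos, one_lt_div hp0]; exact hp1
      have h : ContinuousAt (fun y : ℂ => (1 - y) * (thetaCoeff p (0 - m) / (1 - y * p ^ m))) 1 := by
        fun_prop (disch := assumption)
      simpa using h.tendsto.mono_left (nhdsWithin_le_nhds (s := Metric.ball 0 1))
  · filter_upwards [h1, h2, hball] with y hy1 hy2 hy m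
    have hy3 : ‖1 - y‖ ≤ 2 := (norm_sub_le _ _).trans (by rw [norm_one]; linarith)
    rw [mul_div_left_comm, norm_mul, norm_div]
    refine mul_le_mul_of_nonneg_left ?_ (norm_nonneg _)
    by_cases hm : m = 0
    · rw [hm, zpow_zero, mul_one]
      exact (div_self_le_one _).trans (by linarith [div_pos two_pos hδ])
    · have h3 := (lt_min hy1 hy2).le.trans (le_norm_one_sub_mul_zpow hp hp1 hm)
      have h4 : ‖1 - y‖ / ‖1 - y * p ^ m‖ ≤ 2 / δ := by gcongr
      linarith

/-- By symmetry of the bilateral series the product takes the same value at any nearby-to-1 point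
`x`. There the simple pole of `thetaFraction` meets the simple zero of `θ`, whose factor `1 - x` is
split off the triple product. -/
theorem thetaFraction_mul_thetaSeries {p y : ℂ} (hp : p ≠ 0) (hp1 : ‖p‖ < 1)
    (hy : ‖p‖ < ‖y‖) (hy1 : ‖y‖ < 1) :
    thetaFraction p y 0 * thetaSeries p y = qPoch p p ^ 3 := by
  have hp0 := norm_pos_iff.mpr hp
  have hy0 := (norm_nonneg p).trans_lt hy
  have : (𝓝[Metric.ball 0 1] (1 : ℂ)).NeBot := by
    rw [← mem_closure_iff_nhdsWithin_neBot, closure_ball _ one_ne_zero]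
    simp
  have hball : ∀ᶠ x in 𝓝[Metric.ball 0 1] (1 : ℂ), ‖x‖ < 1 := by
    filter_upwards [self_mem_nhdsWithin] with x hx using mem_ball_zero_iff.mp hx
  have hnorm : Tendsto (fun x : ℂ => ‖x‖) (𝓝[Metric.ball 0 1] (1 : ℂ)) (𝓝 ‖(1 : ℂ)‖) :=
    (Continuous.tendsto (by fun_prop) _).mono_left nhdsWithin_le_nhds
  -- This gives `‖p‖ < ‖x y‖`, so that `θ(xy) ≠ 0` can be cancelled.
  have hlarge := hnorm.eventually_const_lt (show ‖p‖ / ‖y‖ < _ by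
    rw [norm_one, div_lt_one hy0]; exact hy)
  have hbig := hnorm.eventually_const_lt (show ‖p‖ < _ by rwa [norm_one])
  have hcont : Tendsto (fun x => qPoch (x * p) p * qPoch (p / x) p * qPoch p p)
      (𝓝[Metric.ball 0 1] (1 : ℂ)) (𝓝 (qPoch (1 * p) p * qPoch (p / 1) p * qPoch p p)) := by
    have hc := continuous_qPoch_left hp1
    have h1 : ContinuousAt (fun x : ℂ => qPoch (x * p) p) 1 :=
      (hc.comp (continuous_mul_const p)).continuousAt
    have h2 : ContinuousAt (fun x : ℂ => qPoch (p / x) p) 1 :=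
      ContinuousAt.comp (f := fun x : ℂ => p / x) (g := fun a => qPoch a p) hc.continuousAt
        (continuousAt_const.div continuousAt_id one_ne_zero)
    exact ((h1.mul h2).mul continuousAt_const).tendsto.mono_left nhdsWithin_le_nhds
  have hlim := (tendsto_one_sub_mul_thetaFraction hp hp1).mul hcont
  refine tendsto_nhds_unique (tendsto_const_nhds.congr' ?_) (hlim.trans (by
    rw [one_mul, one_mul, div_one]; exact le_of_eq (by congr 1; ring)))
  filter_upwards [hball, hlarge, hbig] with x hx1 hx2 hx
  have hx0 : x ≠ 0 := norm_pos_iff.mp ((norm_nonneg p).trans_lt hx)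
  rw [div_lt_iff₀ hy0, ← norm_mul] at hx2
  have hxy1 : ‖x * y‖ < 1 := by
    rw [norm_mul]; exact mul_lt_one_of_nonneg_of_lt_one_left (norm_nonneg x) hx1 hy1.le
  have e1 := bilateralKronecker_mul_thetaSeries hp hp1 hx hx1 hy hy1
  have e2 := bilateralKronecker_mul_thetaSeries hp hp1 hy hy1 hx hx1
  rw [bilateralKronecker_comm hp hp1 hy hy1 hx hx1, mul_comm y] at e2
  have e3 : thetaFraction p y 0 * thetaSeries p y = thetaFraction p x 0 * thetaSeries p x := by
    refine mul_right_cancel₀ (thetaSeries_ne_zero hp hp1 hx2 hxy1) ?_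
    linear_combination -thetaSeries p y * e1 + thetaSeries p x * e2
  rw [e3, thetaSeries_eq hp hp1 hx0, qPoch_eq_one_sub_mul hp1 x]
  ring

/-- **Kronecker's identity** for the quotient of theta functions. -/
theorem kroneckerSeries_sub_eq {p x y : ℂ} (hp : p ≠ 0) (hp1 : ‖p‖ < 1)
    (hx : ‖p‖ < ‖x‖) (hx1 : ‖x‖ < 1) (hy : ‖p‖ < ‖y‖) (hy1 : ‖y‖ < 1) :
    kroneckerSeries p x y - p / (x * y) * kroneckerSeries p (p / x) (p / y) =
      qPoch (x * y) p * qPoch (p / (x * y)) p * qPoch p p ^ 2 /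
        (qPoch x p * qPoch (p / x) p * (qPoch y p * qPoch (p / y) p)) := by
  have hx0 : x ≠ 0 := norm_pos_iff.mp ((norm_nonneg p).trans_lt hx)
  have hy0 : y ≠ 0 := norm_pos_iff.mp ((norm_nonneg p).trans_lt hy)
  have e1 := bilateralKronecker_mul_thetaSeries hp hp1 hx hx1 hy hy1
  have e2 := thetaFraction_mul_thetaSeries hp hp1 hy hy1
  have hx2 := thetaSeries_ne_zero hp hp1 hx hx1
  have hy2 := thetaSeries_ne_zero hp hp1 hy hy1
  rw [← (hasSum_bilateralKronecker hp hp1 hx hx1 hy hy1).tsum_eq, ← bilateralKronecker]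
  have hP := qPoch_ne_zero hp1 hp1
  have e3 : bilateralKronecker p x y * (thetaSeries p x * thetaSeries p y) =
      qPoch p p ^ 3 * thetaSeries p (x * y) := by
    linear_combination thetaSeries p y * e1 + thetaSeries p (x * y) * e2
  rw [thetaSeries_eq hp hp1 hx0] at e3 hx2
  rw [thetaSeries_eq hp hp1 hy0] at e3 hy2
  rw [thetaSeries_eq hp hp1 (mul_ne_zero hx0 hy0)] at e3
  have hx3 := left_ne_zero_of_mul hx2
  have hy3 := left_ne_zero_of_mul hy2
  rw [eq_div_iff (mul_ne_zero hx3 hy3)]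
  refine mul_right_cancel₀ (pow_ne_zero 2 hP) ?_
  linear_combination e3

/-! ### Divisor sums split by residues modulo 5 -/

/-- The monomial `q^⌊de/5⌋`, restricted to `d ≡ a` and `e ≡ b` modulo `5`. -/
noncomputable def residueTerm (q : ℂ) (a b : ℕ) (i : ℕ × ℕ) : ℂ :=
  if i.1 % 5 = a ∧ i.2 % 5 = b then q ^ (i.1 * i.2 / 5) else 0

theorem hasSum_residueTerm {q : ℂ} (hq : ‖q‖ < 1) {a b : ℕ} (ha : a ≠ 0) (ha5 : a < 5)
    (hb : b ≠ 0) (hb5 : b < 5) :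
    HasSum (residueTerm q a b) (q ^ (a * b / 5) * kroneckerSeries (q ^ 5) (q ^ b) (q ^ a)) := by
  have hpow : ∀ n : ℕ, n ≠ 0 → ‖q ^ n‖ < 1 := fun n hn => by
    rw [norm_pow]; exact pow_lt_one₀ (norm_nonneg q) hq hn
  have hinj : Function.Injective fun i : ℕ × ℕ => (5 * i.1 + a, 5 * i.2 + b) := fun i j h => by
    simp only [Prod.mk.injEq] at h
    exact Prod.ext (by omega) (by omega)
  refine (hinj.hasSum_iff fun i hi => ?_).mp ?_
  · rw [residueTerm, if_neg]
    rintro ⟨h1, h2⟩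
    exact hi ⟨(i.1 / 5, i.2 / 5), Prod.ext (by simp only; omega) (by simp only; omega)⟩
  · refine (congrArg (HasSum · _) (funext fun i => ?_)).mpr
      ((summable_kroneckerSeries (hpow 5 (by norm_num)) (hpow b hb) (hpow a ha)).hasSum.mul_left
        (q ^ (a * b / 5)))
    have h : (5 * i.1 + a) * (5 * i.2 + b) / 5 =
        a * b / 5 + (b * i.1 + a * i.2 + 5 * (i.1 * i.2)) := by
      rw [← Nat.add_mul_div_left _ _ (by norm_num : 0 < 5)]
      congr 1
      ring
    rw [Function.comp_apply, residueTerm, if_pos ⟨by simp only; omega, by simp only; omega⟩, h,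
      pow_add, pow_add, pow_add, pow_mul, pow_mul, pow_mul]

theorem chi45_natCast (d : ℕ) :
    chi45 (d : ZMod 5) = if d % 5 = 1 then 1 else if d % 5 = 2 then -Complex.I else
      if d % 5 = 3 then Complex.I else if d % 5 = 4 then -1 else 0 := by
  rw [← ZMod.natCast_mod]
  have h : d % 5 < 5 := Nat.mod_lt _ (by norm_num)
  generalize d % 5 = u at *
  interval_cases u <;> rfl

/-- The terms of the double series obtained by writing the divisors of `5n + r` as pairs. -/
noncomputable def divisorTerm (q : ℂ) (r : ℕ) (i : ℕ × ℕ) : ℂ :=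
  if i.1 * i.2 % 5 = r then chi45 (i.1 : ZMod 5) * q ^ (i.1 * i.2 / 5) else 0

theorem hasSum_divisorSumChi45_of_divisorTerm {q S : ℂ} {r : ℕ} (hr : r ≠ 0) (hr5 : r < 5)
    (h : HasSum (divisorTerm q r) S) :
    HasSum (fun n : ℕ => divisorSumChi45 (5 * n + r) * q ^ n) S := by
  -- Group the pairs by `⌊de/5⌋ = n`. As `r ≠ 0`, pairs with a zero entry contribute nothing, so
  -- each fibre reduces to the finite set of pairs with product `5n + r`.
  refine (congrArg (HasSum · _) (funext fun n => ?_)).mpr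
    (h.tsum_fiberwise fun i => i.1 * i.2 / 5)
  rw [tsum_subtype ((fun i : ℕ × ℕ => i.1 * i.2 / 5) ⁻¹' {n}) (divisorTerm q r),
    tsum_eq_sum (s := (5 * n + r).divisorsAntidiagonal), divisorSumChi45, sum_mul,
    ← Nat.sum_divisorsAntidiagonal fun d _ => chi45 (d : ZMod 5) * q ^ n]
  · refine sum_congr rfl fun i hi => ?_
    rw [Nat.mem_divisorsAntidiagonal] at hi
    have h1 : i.1 * i.2 / 5 = n := by omega
    have h2 : i.1 * i.2 % 5 = r := by omega
    rw [Set.indicator_of_mem (by simpa using h1), divisorTerm, if_pos h2, h1]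
  · intro i hi
    rw [Nat.mem_divisorsAntidiagonal] at hi
    by_cases h1 : i.1 * i.2 / 5 = n
    · rw [Set.indicator_of_mem (by simpa using h1), divisorTerm, if_neg]
      exact fun h2 => hi ⟨by omega, by omega⟩
    · exact Set.indicator_of_notMem (by simpa using h1) _

/-- The four residue pairs are the solutions of `ab ≡ 1` modulo 5, weighted by the character at `a`;
the next three lemmas are analogous. -/
theorem divisorTerm_one (q : ℂ) (i : ℕ × ℕ) :
    divisorTerm q 1 i = residueTerm q 1 1 i + -Complex.I * residueTerm q 2 3 i +
      Complex.I * residueTerm q 3 2 i - residueTerm q 4 4 i := by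
  rw [divisorTerm, residueTerm, residueTerm, residueTerm, residueTerm, chi45_natCast, Nat.mul_mod]
  have h1 : i.1 % 5 < 5 := Nat.mod_lt _ (by norm_num)
  have h2 : i.2 % 5 < 5 := Nat.mod_lt _ (by norm_num)
  generalize i.1 % 5 = u at *
  generalize i.2 % 5 = v at *
  interval_cases u <;> interval_cases v <;> simp

theorem divisorTerm_two (q : ℂ) (i : ℕ × ℕ) :
    divisorTerm q 2 i = residueTerm q 1 2 i + -Complex.I * residueTerm q 2 1 i +
      Complex.I * residueTerm q 3 4 i - residueTerm q 4 3 i := by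
  rw [divisorTerm, residueTerm, residueTerm, residueTerm, residueTerm, chi45_natCast, Nat.mul_mod]
  have h1 : i.1 % 5 < 5 := Nat.mod_lt _ (by norm_num)
  have h2 : i.2 % 5 < 5 := Nat.mod_lt _ (by norm_num)
  generalize i.1 % 5 = u at *
  generalize i.2 % 5 = v at *
  interval_cases u <;> interval_cases v <;> simp

theorem divisorTerm_three (q : ℂ) (i : ℕ × ℕ) :
    divisorTerm q 3 i = residueTerm q 1 3 i + -Complex.I * residueTerm q 2 4 i +
      Complex.I * residueTerm q 3 1 i - residueTerm q 4 2 i := by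
  rw [divisorTerm, residueTerm, residueTerm, residueTerm, residueTerm, chi45_natCast, Nat.mul_mod]
  have h1 : i.1 % 5 < 5 := Nat.mod_lt _ (by norm_num)
  have h2 : i.2 % 5 < 5 := Nat.mod_lt _ (by norm_num)
  generalize i.1 % 5 = u at *
  generalize i.2 % 5 = v at *
  interval_cases u <;> interval_cases v <;> simp

theorem divisorTerm_four (q : ℂ) (i : ℕ × ℕ) :
    divisorTerm q 4 i = residueTerm q 1 4 i + -Complex.I * residueTerm q 2 2 i +
      Complex.I * residueTerm q 3 3 i - residueTerm q 4 1 i := by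
  rw [divisorTerm, residueTerm, residueTerm, residueTerm, residueTerm, chi45_natCast, Nat.mul_mod]
  have h1 : i.1 % 5 < 5 := Nat.mod_lt _ (by norm_num)
  have h2 : i.2 % 5 < 5 := Nat.mod_lt _ (by norm_num)
  generalize i.1 % 5 = u at *
  generalize i.2 % 5 = v at *
  interval_cases u <;> interval_cases v <;> simp

/-- Kronecker's identity at `p = q^5`; `c`, `d`, `e` are the exponents of `p/x`, `p/y`, `p/(xy)`. Of
two complementary residue pairs, the one with `a + b ≤ 5` is taken. -/
theorem kroneckerSeries_pow {q : ℂ} (hq0 : q ≠ 0) (hq : ‖q‖ < 1) {a b c d e : ℕ} (ha : a ≠ 0)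
    (hb : b ≠ 0) (hc : a + c = 5) (hd : b + d = 5) (he : a + b + e = 5) :
    kroneckerSeries (q ^ 5) (q ^ a) (q ^ b) -
        q ^ e * kroneckerSeries (q ^ 5) (q ^ c) (q ^ d) =
      qPoch (q ^ (a + b)) (q ^ 5) * qPoch (q ^ e) (q ^ 5) * qPoch (q ^ 5) (q ^ 5) ^ 2 /
        (qPoch (q ^ a) (q ^ 5) * qPoch (q ^ c) (q ^ 5) *
          (qPoch (q ^ b) (q ^ 5) * qPoch (q ^ d) (q ^ 5))) := by
  have hn : 0 < ‖q‖ := norm_pos_iff.mpr hq0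
  have hdiv : ∀ m k : ℕ, m + k = 5 → q ^ 5 / q ^ m = q ^ k := fun m k h => by
    rw [← h, pow_add, mul_div_cancel_left₀ _ (pow_ne_zero m hq0)]
  have hlt : ∀ m : ℕ, m ≠ 0 → ‖q ^ m‖ < 1 := fun m hm => by
    rw [norm_pow]; exact pow_lt_one₀ hn.le hq hm
  have hgt : ∀ m : ℕ, m < 5 → ‖q ^ 5‖ < ‖q ^ m‖ := fun m hm => by
    rw [norm_pow, norm_pow]; exact pow_lt_pow_right_of_lt_one₀ hn hq hm
  have h := kroneckerSeries_sub_eq (pow_ne_zero 5 hq0) (hlt 5 (by norm_num)) (hgt a (by omega))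
    (hlt a ha) (hgt b (by omega)) (hlt b hb)
  rwa [← pow_add, hdiv _ _ hc, hdiv _ _ hd, hdiv _ _ he] at h

/-! ### The four generating functions as products -/

theorem qPoch_self_eq {q : ℂ} (hq : ‖q‖ < 1) :
    qPoch q q = qPoch q (q ^ 5) * qPoch (q ^ 2) (q ^ 5) * qPoch (q ^ 3) (q ^ 5) *
      qPoch (q ^ 4) (q ^ 5) * qPoch (q ^ 5) (q ^ 5) := by
  have hq5 : ‖q ^ 5‖ < 1 := by
    rw [norm_pow]; exact pow_lt_one₀ (norm_nonneg q) hq (by norm_num)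
  refine tendsto_nhds_unique ((tendsto_qPoch q q hq).comp
    (tendsto_id.const_mul_atTop' (by norm_num : 0 < 5)))
    (((((tendsto_qPoch q _ hq5).mul (tendsto_qPoch (q ^ 2) _ hq5)).mul
      (tendsto_qPoch (q ^ 3) _ hq5)).mul (tendsto_qPoch (q ^ 4) _ hq5)).mul
      (tendsto_qPoch (q ^ 5) _ hq5) |>.congr fun N => ?_)
  rw [Function.comp_apply, id]
  induction N with
  | zero => simp
  | succ N ih =>
    rw [show 5 * (N + 1) = 5 * N + 1 + 1 + 1 + 1 + 1 by ring]
    simp only [prod_range_succ _ N, prod_range_succ _ (_ + _), prod_range_succ _ (5 * N)]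
    rw [← ih]
    ring

theorem qPoch_zero_zero : qPoch 0 0 = 1 := by simp [qPoch]

theorem hasSum_zero_pow (f : ℕ → ℂ) : HasSum (fun n : ℕ => f n * 0 ^ n) (f 0) := by
  simpa using hasSum_single (f := fun n : ℕ => f n * 0 ^ n) 0 (fun n hn => by simp [hn])

theorem hasSum_divisorSumChi45 {q : ℂ} (hq : ‖q‖ < 1) :
    HasSum (fun n : ℕ => divisorSumChi45 (5 * n + 4) * q ^ n)
      (-Complex.I * qPoch q q * qPoch (q ^ 5) (q ^ 5) /
        (qPoch (q ^ 2) (q ^ 5) ^ 3 * qPoch (q ^ 3) (q ^ 5) ^ 3)) ∧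
    HasSum (fun n : ℕ => divisorSumChi45 (5 * n + 3) * q ^ n)
      ((1 + Complex.I) * qPoch (q ^ 5) (q ^ 5) ^ 2 /
        (qPoch (q ^ 2) (q ^ 5) * qPoch (q ^ 3) (q ^ 5))) ∧
    HasSum (fun n : ℕ => divisorSumChi45 (5 * n + 2) * q ^ n)
      ((1 - Complex.I) * qPoch (q ^ 5) (q ^ 5) ^ 2 /
        (qPoch q (q ^ 5) * qPoch (q ^ 4) (q ^ 5))) ∧
    HasSum (fun n : ℕ => divisorSumChi45 (5 * n + 1) * q ^ n)
      (qPoch q q * qPoch (q ^ 5) (q ^ 5) /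
        (qPoch q (q ^ 5) ^ 3 * qPoch (q ^ 4) (q ^ 5) ^ 3)) := by
  -- Kronecker's identity needs `p ≠ 0`; at `q = 0` only the constant coefficients are compared.
  rcases eq_or_ne q 0 with rfl | hq0
  · have d2 : Nat.divisors 2 = {1, 2} := rfl
    have d3 : Nat.divisors 3 = {1, 3} := rfl
    have d4 : Nat.divisors 4 = {1, 2, 4} := rfl
    refine ⟨?_, ?_, ?_, ?_⟩
    · convert hasSum_zero_pow (fun n => divisorSumChi45 (5 * n + 4)) using 1
      rw [divisorSumChi45, mul_zero, zero_add, d4, sum_insert (by simp), sum_insert (by simp),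
        sum_singleton]
      simp only [chi45_natCast]
      simp [qPoch_zero_zero]
    · convert hasSum_zero_pow (fun n => divisorSumChi45 (5 * n + 3)) using 1
      rw [divisorSumChi45, mul_zero, zero_add, d3, sum_insert (by simp), sum_singleton]
      simp only [chi45_natCast]
      simp [qPoch_zero_zero]
    · convert hasSum_zero_pow (fun n => divisorSumChi45 (5 * n + 2)) using 1
      rw [divisorSumChi45, mul_zero, zero_add, d2, sum_insert (by simp), sum_singleton]
      simp only [chi45_natCast]
      simp [qPoch_zero_zero, sub_eq_add_neg]
    · convert hasSum_zero_pow (fun n => divisorSumChi45 (5 * n + 1)) using 1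
      rw [divisorSumChi45, mul_zero, zero_add, Nat.divisors_one, sum_singleton]
      simp only [chi45_natCast]
      simp [qPoch_zero_zero]
  have hlt : ∀ m : ℕ, m ≠ 0 → ‖q ^ m‖ < 1 := fun m hm => by
    rw [norm_pow]; exact pow_lt_one₀ (norm_nonneg q) hq hm
  have n1 : qPoch q (q ^ 5) ≠ 0 := qPoch_ne_zero hq (hlt 5 (by norm_num))
  have n2 : qPoch (q ^ 2) (q ^ 5) ≠ 0 := qPoch_ne_zero (hlt 2 (by norm_num)) (hlt 5 (by norm_num))
  have n3 : qPoch (q ^ 3) (q ^ 5) ≠ 0 := qPoch_ne_zero (hlt 3 (by norm_num)) (hlt 5 (by norm_num))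
  have n4 : qPoch (q ^ 4) (q ^ 5) ≠ 0 := qPoch_ne_zero (hlt 4 (by norm_num)) (hlt 5 (by norm_num))
  have comb : ∀ {r a b c d : ℕ}, r ≠ 0 → r < 5 → a ≠ 0 ∧ a < 5 → b ≠ 0 ∧ b < 5 → c ≠ 0 ∧ c < 5 →
      d ≠ 0 ∧ d < 5 → (∀ i, divisorTerm q r i = residueTerm q 1 a i + -Complex.I * residueTerm q 2 b i +
        Complex.I * residueTerm q 3 c i - residueTerm q 4 d i) →
      HasSum (fun n : ℕ => divisorSumChi45 (5 * n + r) * q ^ n)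
        (q ^ (1 * a / 5) * kroneckerSeries (q ^ 5) (q ^ a) (q ^ 1) +
          -Complex.I * (q ^ (2 * b / 5) * kroneckerSeries (q ^ 5) (q ^ b) (q ^ 2)) +
          Complex.I * (q ^ (3 * c / 5) * kroneckerSeries (q ^ 5) (q ^ c) (q ^ 3)) -
          q ^ (4 * d / 5) * kroneckerSeries (q ^ 5) (q ^ d) (q ^ 4)) := by
    intro r a b c d hr0 hr5 ha hb hc hd h
    refine hasSum_divisorSumChi45_of_divisorTerm hr0 hr5 ((congrArg (HasSum · _) (funext h)).mpr ?_)
    exact (((hasSum_residueTerm hq one_ne_zero (by norm_num) ha.1 ha.2).add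
      ((hasSum_residueTerm hq two_ne_zero (by norm_num) hb.1 hb.2).mul_left _)).add
      ((hasSum_residueTerm hq three_ne_zero (by norm_num) hc.1 hc.2).mul_left _)).sub
      (hasSum_residueTerm hq four_ne_zero (by norm_num) hd.1 hd.2)
  refine ⟨?_, ?_, ?_, ?_⟩
  · have k := kroneckerSeries_pow hq0 hq (a := 2) (b := 2) (c := 3) (d := 3) (e := 1)
      (by norm_num) (by norm_num) rfl rfl rfl
    convert comb (r := 4) (a := 4) (b := 2) (c := 3) (d := 1) (by norm_num) (by norm_num)
      (by norm_num) (by norm_num) (by norm_num) (by norm_num) (divisorTerm_four q) using 1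
    -- The pairs `(1, 4)` and `(4, 1)` cancel by symmetry of the double series; for `r = 1` the
    -- pairs `(2, 3)` and `(3, 2)` do.
    trans -Complex.I * (kroneckerSeries (q ^ 5) (q ^ 2) (q ^ 2) -
      q ^ 1 * kroneckerSeries (q ^ 5) (q ^ 3) (q ^ 3))
    · rw [k, qPoch_self_eq hq]
      simp only [Nat.reduceAdd, pow_one]
      field_simp
    · rw [kroneckerSeries_comm _ (q ^ 4)]
      norm_num
      ring
  · have k := kroneckerSeries_pow hq0 hq (a := 3) (b := 1) (c := 2) (d := 4) (e := 1)
      (by norm_num) (by norm_num) rfl rfl rfl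
    convert comb (r := 3) (a := 3) (b := 4) (c := 1) (d := 2) (by norm_num) (by norm_num)
      (by norm_num) (by norm_num) (by norm_num) (by norm_num) (divisorTerm_three q) using 1
    -- Nothing cancels here: symmetry merges the four series into two, with common factor `1 + i`.
    trans (1 + Complex.I) * (kroneckerSeries (q ^ 5) (q ^ 3) (q ^ 1) -
      q ^ 1 * kroneckerSeries (q ^ 5) (q ^ 2) (q ^ 4))
    · rw [k]
      simp only [Nat.reduceAdd, pow_one]
      field_simp
    · rw [kroneckerSeries_comm _ (q ^ 4), kroneckerSeries_comm _ (q ^ 3)]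
      norm_num
      ring
  · have k := kroneckerSeries_pow hq0 hq (a := 2) (b := 1) (c := 3) (d := 4) (e := 2)
      (by norm_num) (by norm_num) rfl rfl rfl
    convert comb (r := 2) (a := 2) (b := 1) (c := 4) (d := 3) (by norm_num) (by norm_num)
      (by norm_num) (by norm_num) (by norm_num) (by norm_num) (divisorTerm_two q) using 1
    trans (1 - Complex.I) * (kroneckerSeries (q ^ 5) (q ^ 2) (q ^ 1) -
      q ^ 2 * kroneckerSeries (q ^ 5) (q ^ 3) (q ^ 4))
    · rw [k]
      simp only [Nat.reduceAdd, pow_one]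
      field_simp
    · rw [kroneckerSeries_comm _ (q ^ 4), kroneckerSeries_comm _ (q ^ 2)]
      norm_num
      ring
  · have k := kroneckerSeries_pow hq0 hq (a := 1) (b := 1) (c := 4) (d := 4) (e := 3)
      (by norm_num) (by norm_num) rfl rfl rfl
    convert comb (r := 1) (a := 1) (b := 3) (c := 2) (d := 4) (by norm_num) (by norm_num)
      (by norm_num) (by norm_num) (by norm_num) (by norm_num) (divisorTerm_one q) using 1
    trans kroneckerSeries (q ^ 5) (q ^ 1) (q ^ 1) -
      q ^ 3 * kroneckerSeries (q ^ 5) (q ^ 4) (q ^ 4)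
    · rw [k, qPoch_self_eq hq]
      simp only [Nat.reduceAdd, pow_one]
      field_simp
    · rw [kroneckerSeries_comm _ (q ^ 3)]
      norm_num

/-! ### The quintic theta functions as products -/

theorem qqPow_pow_five_mul {q : ℂ} (hq : ‖q‖ < 1) : qqPow q (-3 / 5) ^ 5 * qPoch q q ^ 3 = 1 := by
  rw [← qqPow_one q hq, qqPow, qqPow, ← Complex.exp_nat_mul, ← Complex.exp_nat_mul,
    ← Complex.exp_add]
  trans Complex.exp 0
  · congr 1
    push_cast
    ring
  · exact Complex.exp_zero

/-- With `2d = 5 - c` the exponent is `5 · n(n-1)/2 + d n`; `A` uses `c = 3`, `d = 1` and `B` uses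
`c = 1`, `d = 2`. -/
theorem tsum_quintic_eq_thetaSeries {q : ℂ} (hq0 : q ≠ 0) (c d : ℤ) (h : 2 * d = 5 - c) :
    ∑' n : ℤ, (-1 : ℂ) ^ n * q ^ ((5 * n ^ 2 - c * n) / 2) = thetaSeries (q ^ 5) (q ^ d) := by
  refine tsum_congr fun n => ?_
  obtain ⟨k, hk⟩ := (Int.even_mul_pred_self n).two_dvd
  have h1 : 5 * n ^ 2 - c * n = 2 * (5 * k + d * n) := by
    linear_combination 5 * hk - n * h
  rw [thetaCoeff, hk, h1, Int.mul_ediv_cancel_left _ two_ne_zero,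
    Int.mul_ediv_cancel_left _ two_ne_zero, zpow_add₀ hq0, zpow_mul, zpow_mul, mul_assoc]
  norm_cast

theorem quinticA_eq {t : ℂ} (ht : t ≠ 0) (ht1 : ‖t ^ 5‖ < 1) :
    quinticA t = t * qqPow (t ^ 5) (-3 / 5) * (qPoch (t ^ 5) ((t ^ 5) ^ 5) *
      qPoch ((t ^ 5) ^ 4) ((t ^ 5) ^ 5) * qPoch ((t ^ 5) ^ 5) ((t ^ 5) ^ 5)) := by
  have hq0 := pow_ne_zero 5 ht
  rw [quinticA]
  generalize t ^ 5 = q at *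
  have hq5 : ‖q ^ 5‖ < 1 := by
    rw [norm_pow]; exact pow_lt_one₀ (norm_nonneg q) ht1 (by norm_num)
  rw [tsum_quintic_eq_thetaSeries hq0 3 1 (by norm_num), zpow_one,
    thetaSeries_eq (pow_ne_zero 5 hq0) hq5 hq0, pow_succ q 4, mul_div_cancel_right₀ _ hq0]

theorem quinticB_eq {q : ℂ} (hq0 : q ≠ 0) (hq : ‖q‖ < 1) :
    quinticB q = qqPow q (-3 / 5) * (qPoch (q ^ 2) (q ^ 5) *
      qPoch (q ^ 3) (q ^ 5) * qPoch (q ^ 5) (q ^ 5)) := by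
  have hq5 : ‖q ^ 5‖ < 1 := by
    rw [norm_pow]; exact pow_lt_one₀ (norm_nonneg q) hq (by norm_num)
  have h := tsum_quintic_eq_thetaSeries hq0 1 2 (by norm_num)
  simp only [one_mul] at h
  have hd : q ^ 5 / q ^ 2 = q ^ 3 := by field_simp
  rw [quinticB, h, show q ^ (2 : ℤ) = q ^ 2 by norm_cast,
    thetaSeries_eq (pow_ne_zero 5 hq0) hq5 (pow_ne_zero 2 hq0), hd]

theorem theorem1p3 :
    (∀ q : ℂ, ‖q‖ < 1 →
      HasSum (fun n : ℕ => divisorSumChi45 (5 * n + 4) * q ^ n)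
        (-Complex.I * qPoch q q * qPoch (q ^ 5) (q ^ 5) /
          (qPoch (q ^ 2) (q ^ 5) ^ 3 * qPoch (q ^ 3) (q ^ 5) ^ 3)) ∧
      HasSum (fun n : ℕ => divisorSumChi45 (5 * n + 3) * q ^ n)
        ((1 + Complex.I) * qPoch (q ^ 5) (q ^ 5) ^ 2 /
          (qPoch (q ^ 2) (q ^ 5) * qPoch (q ^ 3) (q ^ 5))) ∧
      HasSum (fun n : ℕ => divisorSumChi45 (5 * n + 2) * q ^ n)
        ((1 - Complex.I) * qPoch (q ^ 5) (q ^ 5) ^ 2 /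
          (qPoch q (q ^ 5) * qPoch (q ^ 4) (q ^ 5))) ∧
      HasSum (fun n : ℕ => divisorSumChi45 (5 * n + 1) * q ^ n)
        (qPoch q q * qPoch (q ^ 5) (q ^ 5) /
          (qPoch q (q ^ 5) ^ 3 * qPoch (q ^ 4) (q ^ 5) ^ 3))) ∧
    (∀ q t : ℂ, ‖q‖ < 1 → t ^ 5 = q →
      t ^ 4 * ∑' n : ℕ, divisorSumChi45 (5 * n + 4) * q ^ n
        = -Complex.I * quinticA t ^ 4 * quinticB q ∧
      t ^ 3 * ∑' n : ℕ, divisorSumChi45 (5 * n + 3) * q ^ n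
        = (1 + Complex.I) * quinticA t ^ 3 * quinticB q ^ 2 ∧
      t ^ 2 * ∑' n : ℕ, divisorSumChi45 (5 * n + 2) * q ^ n
        = (1 - Complex.I) * quinticA t ^ 2 * quinticB q ^ 3 ∧
      t * ∑' n : ℕ, divisorSumChi45 (5 * n + 1) * q ^ n
        = quinticA t * quinticB q ^ 4) := by
  refine ⟨fun q hq => hasSum_divisorSumChi45 hq, fun q t hq ht => ?_⟩
  -- At `t = 0` both sides vanish, since every right-hand side contains `A`.
  rcases eq_or_ne t 0 with rfl | ht0
  · simp [quinticA]
  have hq0 : q ≠ 0 := ht ▸ pow_ne_zero 5 ht0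
  obtain ⟨s4, s3, s2, s1⟩ := hasSum_divisorSumChi45 hq
  have hA := quinticA_eq ht0 (ht.symm ▸ hq)
  rw [ht] at hA
  have hlt : ∀ m : ℕ, m ≠ 0 → ‖q ^ m‖ < 1 := fun m hm => by
    rw [norm_pow]; exact pow_lt_one₀ (norm_nonneg q) hq hm
  have n1 : qPoch q (q ^ 5) ≠ 0 := qPoch_ne_zero hq (hlt 5 (by norm_num))
  have n2 : qPoch (q ^ 2) (q ^ 5) ≠ 0 := qPoch_ne_zero (hlt 2 (by norm_num)) (hlt 5 (by norm_num))
  have n3 : qPoch (q ^ 3) (q ^ 5) ≠ 0 := qPoch_ne_zero (hlt 3 (by norm_num)) (hlt 5 (by norm_num))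
  have n4 : qPoch (q ^ 4) (q ^ 5) ≠ 0 := qPoch_ne_zero (hlt 4 (by norm_num)) (hlt 5 (by norm_num))
  have n5 : qPoch (q ^ 5) (q ^ 5) ≠ 0 := qPoch_ne_zero (hlt 5 (by norm_num)) (hlt 5 (by norm_num))
  have hE : qqPow q (-3 / 5) ^ 5 = 1 / qPoch q q ^ 3 :=
    eq_div_of_mul_eq (pow_ne_zero 3 (qPoch_ne_zero hq hq)) (qqPow_pow_five_mul hq)
  rw [s4.tsum_eq, s3.tsum_eq, s2.tsum_eq, s1.tsum_eq, hA, quinticB_eq hq0 hq]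
  -- Once `(q; q)_∞` is split into its five residue classes, each claim is a rational identity in
  -- those products, given the value of `E^5`.
  rw [qPoch_self_eq hq] at hE ⊢
  generalize qqPow q (-3 / 5) = E at *
  generalize qPoch q (q ^ 5) = a1 at *
  generalize qPoch (q ^ 2) (q ^ 5) = a2 at *
  generalize qPoch (q ^ 3) (q ^ 5) = a3 at *
  generalize qPoch (q ^ 4) (q ^ 5) = a4 at *
  generalize qPoch (q ^ 5) (q ^ 5) = a5 at *
  refine ⟨?_, ?_, ?_, ?_⟩
  · trans -Complex.I * t ^ 4 * E ^ 5 * (a1 * a4 * a5) ^ 4 * (a2 * a3 * a5)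
    · rw [hE]; field_simp
    · ring
  · trans (1 + Complex.I) * t ^ 3 * E ^ 5 * (a1 * a4 * a5) ^ 3 * (a2 * a3 * a5) ^ 2
    · rw [hE]; field_simp
    · ring
  · trans (1 - Complex.I) * t ^ 2 * E ^ 5 * (a1 * a4 * a5) ^ 2 * (a2 * a3 * a5) ^ 3
    · rw [hE]; field_simp
    · ring
  · trans t * E ^ 5 * (a1 * a4 * a5) * (a2 * a3 * a5) ^ 4
    · rw [hE]; field_simp
    · ring
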